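/- Let $n \ge 0$ and let $S_n$ be the symmetric group on $[n]=\{1,\dots,n\}$, with simple generators $s_i=(i,i+1)$ for $1\le i<n$ and Coxeter length $\ell$. Let $\circ$ denote the Demazure product on $S_n$, i.e. the unique associative product such that for every $w \in S_n$ and every simple generator $s$ one has $w\circ s = ws$ if $\ell(ws)>\ell(w)$ and $w\circ s=w$ otherwise, and $s\circ w = sw$ if $\ell(sw)>\ell(w)$ and $s\circ w=w$ otherwise. For $x \in S_n$ with $x=x^{-1}$ let $\mathcal B(x)=\{w\in S_n : w^{-1}\circ 1\circ w = x\}$, let $\mathcal A(x)$ be the set of elements of minimal length in $\mathcal B(x)$ (the atoms of $x$), and let $\mathcal A(x)^{-1}=\{w^{-1} : w\in\mathcal A(x)\}$. Let $\prec_{\mathcal A}$ be the transitive closure of the relation on finite integer sequences with $[\cdots c,a,b \cdots] \prec_{\mathcal A} [\cdots b,c,a\cdots]$ whenever $a\le b\le c$, where $c,a,b$ and $b,c,a$ occupy the same three consecutive positions and the two sequences agree in all other positions. Identify $w\in S_n$ with its one-line representation $[w(1),\dots,w(n)]$, and for $u,v\in S_n$ write $u\preceq_{\mathcal A} v$ if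 $u=v$ or $u\prec_{\mathcal A} v$. For $x \in S_n$ with $x=x^{-1}$ let $\mathrm{Cyc}(x)=\{(a,b)\in[n]\times[n] : a\le b=x(a)\}$. List its elements as $(a_1,b_1),\dots,(a_k,b_k)$ with $a_1<\dots<a_k$, and also as $(c_1,d_1),\dots,(c_k,d_k)$ with $d_1<\dots<d_k$. Let $\hat 0(x)$ and $\hat 1(x)$ be the permutations in $S_n$ whose one-line representations are obtained from $[b_1,a_1,b_2,a_2,\dots,b_k,a_k]$ and $[d_1,c_1,d_2,c_2,\dots,d_k,c_k]$, respectively, by omitting all repeated entries after their first occurrence. Theorem. The relation $\preceq_{\mathcal A}$ is a partial order on $S_n$, and for every $x\in S_n$ with $x=x^{-1}$, $$\mathcal A(x)^{-1}=\{u\in S_n : \hat 0(x)\preceq_{\mathcal A} u\}=\{u\in S_n : u\preceq_{\mathcal A}\hat 1(x)\}.$$ Consequently $\mathcal A(x)^{-1}=\{u\in S_n : \hat 0(x)\preceq_{\mathcal A} u\preceq_{\mathcal A}\hat 1(x)\}$. -/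

import Mathlib

namespace InvAtoms

/-! ### The symmetric group as a Coxeter group

`S_n` is `Equiv.Perm (Fin n)`, with `Fin n = {0, …, n-1}` in the role of `[n] = {1, …, n}`, and
`(u * v) i = u (v i)`. -/

/-- The simple generators of `S_n`: the transpositions of two adjacent points. -/
def simpleReflections (n : ℕ) : Set (Equiv.Perm (Fin n)) :=
  {s | ∃ i j : Fin n, (i : ℕ) + 1 = (j : ℕ) ∧ s = Equiv.swap i j}

/-- `l` is a word in the simple generators with product `w`. -/
def IsWord {n : ℕ} (w : Equiv.Perm (Fin n)) (l : List (Equiv.Perm (Fin n))) : Prop :=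
  (∀ s ∈ l, s ∈ simpleReflections n) ∧ l.prod = w

/-- The Coxeter length: the least number of factors in a word for `w`. -/
noncomputable def len {n : ℕ} (w : Equiv.Perm (Fin n)) : ℕ :=
  sInf {k | ∃ l, IsWord w l ∧ l.length = k}

/-- A reduced word: a word for `w` of the shortest possible length. -/
def IsReducedWord {n : ℕ} (w : Equiv.Perm (Fin n)) (l : List (Equiv.Perm (Fin n))) : Prop :=
  IsWord w l ∧ l.length = len w

theorem exists_isWord {n : ℕ} (w : Equiv.Perm (Fin n)) : ∃ l, IsWord w l := by
  cases n with
  | zero => exact ⟨[], by simp, Subsingleton.elim _ _⟩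
  | succ n =>
    have h : w ∈ Submonoid.closure
        (Set.range fun i : Fin n => Equiv.swap i.castSucc i.succ) := by
      rw [Equiv.Perm.mclosure_swap_castSucc_succ]; trivial
    obtain ⟨l, hl, hw⟩ := Submonoid.exists_list_of_mem_closure h
    refine ⟨l, fun s hs => ?_, hw⟩
    obtain ⟨i, rfl⟩ := hl s hs
    exact ⟨i.castSucc, i.succ, by simp, rfl⟩

theorem exists_isReducedWord {n : ℕ} (w : Equiv.Perm (Fin n)) : ∃ l, IsReducedWord w l := by
  have h : {k | ∃ l, IsWord w l ∧ l.length = k}.Nonempty := by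
    obtain ⟨l, hl⟩ := exists_isWord w
    exact ⟨_, l, hl, rfl⟩
  obtain ⟨l, hl, hk⟩ := Nat.sInf_mem h
  exact ⟨l, hl, hk⟩

/-! ### The Demazure product, Hecke atoms and atoms -/

/-- `u ∘ s` for a simple generator `s`: it is `u * s` if that is longer than `u`, and `u`
otherwise. -/
noncomputable def demazureRight {n : ℕ} (u s : Equiv.Perm (Fin n)) : Equiv.Perm (Fin n) :=
  if len u < len (u * s) then u * s else u

/-- The Demazure product `u ∘ w = (⋯((u ∘ s₁) ∘ s₂) ⋯) ∘ s_k`, where `w = s₁ s₂ ⋯ s_k` is a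
reduced word (the result does not depend on which one). -/
noncomputable def demazure {n : ℕ} (u w : Equiv.Perm (Fin n)) : Equiv.Perm (Fin n) :=
  (exists_isReducedWord w).choose.foldl demazureRight u

/-- The operation `x ⋊ w = w⁻¹ ∘ x ∘ w`. -/
noncomputable def demazureConj {n : ℕ} (x w : Equiv.Perm (Fin n)) : Equiv.Perm (Fin n) :=
  demazure (demazure w⁻¹ x) w

/-- The Hecke atoms `B(x, y) = {w : x ⋊ w = y}` of `y` relative to `x`. -/
def heckeAtoms {n : ℕ} (x y : Equiv.Perm (Fin n)) : Set (Equiv.Perm (Fin n)) :=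
  {w | demazureConj x w = y}

/-- The atoms `A(x, y)` of `y` relative to `x`: the elements of minimal length in `B(x, y)`. -/
def relAtoms {n : ℕ} (x y : Equiv.Perm (Fin n)) : Set (Equiv.Perm (Fin n)) :=
  {w | w ∈ heckeAtoms x y ∧ ∀ v ∈ heckeAtoms x y, len w ≤ len v}

/-- The atoms `A(y) = A(1, y)`. -/
def atoms {n : ℕ} (y : Equiv.Perm (Fin n)) : Set (Equiv.Perm (Fin n)) :=
  relAtoms 1 y

/-! ### The order generated by `[⋯ c,a,b ⋯] ≺ [⋯ b,c,a ⋯]` -/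

/-- The generating relation on integer sequences: replace one consecutive triple `c,a,b` with
`a ≤ b ≤ c` by `b,c,a`. -/
def AtomStep (l m : List ℤ) : Prop :=
  ∃ (p q : List ℤ) (a b c : ℤ), a ≤ b ∧ b ≤ c ∧
    l = p ++ [c, a, b] ++ q ∧ m = p ++ [b, c, a] ++ q

/-- `≺` on integer sequences: the transitive closure of the generating relation. -/
def AtomLT (l m : List ℤ) : Prop :=
  Relation.TransGen AtomStep l m

/-- The one-line representation `[w₁, …, w_n]`, with entries in `{1, …, n}`. -/
def oneLine {n : ℕ} (w : Equiv.Perm (Fin n)) : List ℤ :=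
  List.ofFn fun i => ((w i : ℕ) : ℤ) + 1

/-- `u ⪯ v` on `S_n`: either `u = v`, or `u ≺ v` in one-line notation. -/
def AtomLE {n : ℕ} (u v : Equiv.Perm (Fin n)) : Prop :=
  u = v ∨ AtomLT (oneLine u) (oneLine v)

/-! ### The extremal permutations `0̂(x)` and `1̂(x)` -/

/-- The cycle set `Cyc(x) = {(a, b) : a ≤ b = x(a)}`. -/
def Cyc {n : ℕ} (x : Equiv.Perm (Fin n)) : Set (Fin n × Fin n) :=
  {p | p.1 ≤ p.2 ∧ p.2 = x p.1}

/-- The elements `(a₁, b₁), (a₂, b₂), …` of `Cyc(x)`, listed with `a₁ < a₂ < ⋯`. -/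
def cycByMin {n : ℕ} (x : Equiv.Perm (Fin n)) : List (Fin n × Fin n) :=
  ((List.finRange n).map fun a => (a, x a)).filter fun p => p.1 ≤ p.2

/-- The elements `(c₁, d₁), (c₂, d₂), …` of `Cyc(x)`, listed with `d₁ < d₂ < ⋯`. -/
def cycByMax {n : ℕ} (x : Equiv.Perm (Fin n)) : List (Fin n × Fin n) :=
  ((List.finRange n).map fun d => (x⁻¹ d, d)).filter fun p => p.1 ≤ p.2

theorem mem_cycByMin {n : ℕ} (x : Equiv.Perm (Fin n)) (p : Fin n × Fin n) :
    p ∈ cycByMin x ↔ p ∈ Cyc x := by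
  obtain ⟨a, b⟩ := p
  simp only [cycByMin, Cyc, List.mem_filter, List.mem_map, List.mem_finRange, true_and,
    Prod.mk.injEq, decide_eq_true_eq, Set.mem_ofPred_eq]
  constructor
  · rintro ⟨⟨c, rfl, rfl⟩, h⟩
    exact ⟨h, rfl⟩
  · rintro ⟨h, rfl⟩
    exact ⟨⟨a, rfl, rfl⟩, h⟩

theorem mem_cycByMax {n : ℕ} (x : Equiv.Perm (Fin n)) (p : Fin n × Fin n) :
    p ∈ cycByMax x ↔ p ∈ Cyc x := by
  obtain ⟨a, b⟩ := p
  simp only [cycByMax, Cyc, List.mem_filter, List.mem_map, List.mem_finRange, true_and,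
    Prod.mk.injEq, decide_eq_true_eq, Set.mem_ofPred_eq]
  constructor
  · rintro ⟨⟨c, rfl, rfl⟩, h⟩
    exact ⟨h, by simp⟩
  · rintro ⟨h, rfl⟩
    exact ⟨⟨x a, by simp, rfl⟩, h⟩

theorem cycByMin_sorted {n : ℕ} (x : Equiv.Perm (Fin n)) :
    (cycByMin x).Pairwise fun p q => p.1 < q.1 := by
  refine List.Pairwise.filter _ (List.pairwise_map.2 ?_)
  exact List.pairwise_lt_finRange n

theorem cycByMax_sorted {n : ℕ} (x : Equiv.Perm (Fin n)) :
    (cycByMax x).Pairwise fun p q => p.2 < q.2 := by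
  refine List.Pairwise.filter _ (List.pairwise_map.2 ?_)
  exact List.pairwise_lt_finRange n

/-- `[[b₁, a₁, b₂, a₂, …]]` for a list of pairs `(a₁, b₁), (a₂, b₂), …`, where `[[⋯]]` omits all
repeated entries after their initial occurrence. -/
def interleave {n : ℕ} (L : List (Fin n × Fin n)) : List (Fin n) :=
  (L.flatMap fun p => [p.2, p.1]).eraseDups

theorem nodup_eraseDups {n : ℕ} (l : List (Fin n)) : l.eraseDups.Nodup := by
  induction h : l.length using Nat.strong_induction_on generalizing l with
  | _ k ih =>
    cases l with
    | nil => simp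
    | cons a as =>
      rw [List.eraseDups_cons, List.nodup_cons]
      refine ⟨by simp [List.mem_eraseDups], ih _ ?_ _ rfl⟩
      rw [← h, List.length_cons]
      exact Nat.lt_succ_of_le (List.length_filter_le _ _)

theorem mem_interleave {n : ℕ} (x : Equiv.Perm (Fin n)) (hx : x⁻¹ = x)
    (L : List (Fin n × Fin n)) (hL : ∀ p, p ∈ L ↔ p ∈ Cyc x) (i : Fin n) :
    i ∈ interleave L := by
  have hxx : x (x i) = i := by
    nth_rewrite 1 [← hx]
    simp
  rw [interleave, List.mem_eraseDups, List.mem_flatMap]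
  rcases le_total i (x i) with h | h
  · exact ⟨(i, x i), (hL _).2 ⟨h, rfl⟩, by simp⟩
  · exact ⟨(x i, i), (hL _).2 ⟨h, hxx.symm⟩, by simp⟩

/-- The permutation whose one-line representation is a given list containing every element of
`Fin n` exactly once. -/
def ofOneLine {n : ℕ} (l : List (Fin n)) (hl : l.Nodup) (h : ∀ i, i ∈ l) :
    Equiv.Perm (Fin n) :=
  (finCongr (by
    have := Fintype.card_congr (hl.getEquivOfForallMemList l h)
    simpa using this.symm)).trans (hl.getEquivOfForallMemList l h)

theorem ofFn_ofOneLine {n : ℕ} (l : List (Fin n)) (hl : l.Nodup) (h : ∀ i, i ∈ l) :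
    List.ofFn (ofOneLine l hl h) = l := by
  have hn : l.length = n := by
    simpa using Fintype.card_congr (hl.getEquivOfForallMemList l h)
  refine List.ext_getElem (by simp [hn]) fun i h1 h2 => ?_
  simp [ofOneLine]

/-- `0̂(x) = [[b₁, a₁, …, b_k, a_k]]`, where `(a₁, b₁), …, (a_k, b_k)` are the elements of `Cyc(x)`
with `a₁ < ⋯ < a_k`. -/
def zeroHat {n : ℕ} (x : Equiv.Perm (Fin n)) (hx : x⁻¹ = x) : Equiv.Perm (Fin n) :=
  ofOneLine (interleave (cycByMin x)) (nodup_eraseDups _) (mem_interleave x hx _ (mem_cycByMin x))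

/-- `1̂(x) = [[d₁, c₁, …, d_k, c_k]]`, where `(c₁, d₁), …, (c_k, d_k)` are the elements of `Cyc(x)`
with `d₁ < ⋯ < d_k`. -/
def oneHat {n : ℕ} (x : Equiv.Perm (Fin n)) (hx : x⁻¹ = x) : Equiv.Perm (Fin n) :=
  ofOneLine (interleave (cycByMax x)) (nodup_eraseDups _) (mem_interleave x hx _ (mem_cycByMax x))

end InvAtoms

/-! Put `u = w⁻¹`: inverse atoms of `x` are the shortest `u` with `u ∘ u⁻¹ = x`. Let `m` have
increasing entries `a < b < c` in three consecutive positions, and let `cab`, `bca`, `cba` be its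
rearrangements there. Evaluating `u ∘ u⁻¹` letter by letter gives `cba ∘ m⁻¹` for all three. As
`cab` and `bca` have equal length, a covering step changes neither `u ∘ u⁻¹` nor the length, so the
set of inverse atoms is closed under steps in both directions (`CoverStep.mem_inv_atoms_iff`). As
`cba` is longer, it never occurs consecutively in an inverse atom (`not_cba_of_mem_inv_atoms`).

Each step lowers the one-line word lexicographically, which yields antisymmetry and, by finiteness,
a minimal and a maximal element on descending and ascending chains. A minimal inverse atom avoids
consecutive `cba` and `bca`. Its descents are then disjoint; pairing the two values of each descent
defines an involution `y`, and the word lists the cycles of `y` by increasing minimum, larger entry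
first (`exists_keySorted_min`). Any word sorted in this way satisfies `u ∘ u⁻¹ = y`
(`KeySorted.demazure_eq`), so `y = x` and the word is `0̂(x)`. Maximal inverse atoms avoid `cab`
instead, are sorted by cycle maximum, and equal `1̂(x)`.

Thus every inverse atom lies above `0̂(x)` and below `1̂(x)`. Since inverse atoms exist, closure
under steps makes these two inverse atoms as well, together with everything comparable to either. -/

namespace InvAtoms

open Equiv

variable {n : ℕ}

/-! ### Coxeter length as the number of inversions. -/

/-- The inversions of a permutation, as pairs of positions. -/
def inversions (w : Perm (Fin n)) : Finset (Fin n × Fin n) :=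
  Finset.univ.filter fun p => p.1 < p.2 ∧ w p.2 < w p.1

theorem mem_inversions {w : Perm (Fin n)} {p : Fin n × Fin n} :
    p ∈ inversions w ↔ p.1 < p.2 ∧ w p.2 < w p.1 := by
  simp only [inversions, Finset.mem_filter_univ]

theorem inversions_one : inversions (1 : Perm (Fin n)) = ∅ := by
  refine Finset.eq_empty_of_forall_notMem fun p hp => ?_
  rw [mem_inversions] at hp
  exact lt_asymm hp.1 hp.2

/-- No element lies strictly between `i` and `j`, so only the pair `(i, j)` itself can have its
order reversed. -/
theorem swap_lt_swap {i j a b : Fin n} (h : (i : ℕ) + 1 = j) (hab : a < b)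
    (hne : ¬ (a = i ∧ b = j)) : swap i j a < swap i j b := by
  rw [Fin.lt_def] at hab ⊢
  simp only [swap_apply_def, Fin.ext_iff] at hne ⊢
  split_ifs <;> omega

theorem swap_lt_swap_iff {i j a b : Fin n} (h : (i : ℕ) + 1 = j)
    (hne : ¬ (a = i ∧ b = j)) (hne' : ¬ (a = j ∧ b = i)) :
    swap i j a < swap i j b ↔ a < b := by
  refine ⟨fun hab => ?_, fun hab => swap_lt_swap h hab hne⟩
  have := swap_lt_swap h hab (by
    rintro ⟨h1, h2⟩
    rw [swap_apply_eq_iff, swap_apply_left] at h1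
    rw [swap_apply_eq_iff, swap_apply_right] at h2
    exact hne' ⟨h1, h2⟩)
  simpa using this

theorem card_inversions_mul_swap {w : Perm (Fin n)} {i j : Fin n} (h : (i : ℕ) + 1 = j)
    (hw : w i < w j) : (inversions (w * swap i j)).card = (inversions w).card + 1 := by
  have hij : i < j := by rw [Fin.lt_def]; omega
  -- Moving positions by the transposition matches the inversions of `w` with those of the product
  -- other than `(i, j)`.
  have key : inversions (w * swap i j) = insert (i, j)
      ((inversions w).map (Equiv.prodCongr (swap i j) (swap i j)).toEmbedding) := by
    ext ⟨p, q⟩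
    simp only [mem_inversions, Finset.mem_insert,
      Finset.mem_map_equiv, Prod.mk.injEq, Perm.mul_apply, Equiv.prodCongr_symm,
      Equiv.prodCongr_apply, Prod.map, symm_swap]
    constructor
    · rintro ⟨h1, h2⟩
      by_cases hc : p = i ∧ q = j
      · exact Or.inl hc
      · exact Or.inr ⟨swap_lt_swap h h1 hc, h2⟩
    · rintro (⟨rfl, rfl⟩ | ⟨h1, h2⟩)
      · simpa using ⟨hij, hw⟩
      · refine ⟨?_, h2⟩
        have := swap_lt_swap h h1 (by
          rintro ⟨h3, h4⟩
          rw [h3, h4] at h2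
          exact lt_asymm h2 hw)
        simpa using this
  rw [key, Finset.card_insert_of_notMem, Finset.card_map]
  simp only [mem_inversions, Finset.mem_map_equiv,
    Equiv.prodCongr_symm, Equiv.prodCongr_apply, Prod.map, symm_swap, swap_apply_left,
    swap_apply_right]
  exact fun hc => lt_asymm hc.1 hij

theorem card_inversions_mul_swap_of_gt {w : Perm (Fin n)} {i j : Fin n} (h : (i : ℕ) + 1 = j)
    (hw : w j < w i) : (inversions (w * swap i j)).card + 1 = (inversions w).card := by
  have := card_inversions_mul_swap (w := w * swap i j) h (by simpa using hw)
  rw [mul_assoc, swap_mul_self, mul_one] at this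
  exact this.symm

theorem eq_one_of_lt_succ {w : Perm (Fin n)}
    (h : ∀ i j : Fin n, (i : ℕ) + 1 = j → w i < w j) : w = 1 := by
  have hm : StrictMono w := by
    cases n with
    | zero => exact fun a => a.elim0
    | succ n => exact Fin.strictMono_iff_lt_succ.2 fun i => h _ _ (by simp)
  ext i
  have := congrFun (Subsingleton.elim (hm.orderIsoOfSurjective w w.surjective)
    (OrderIso.refl (Fin n)) ▸ rfl : ((hm.orderIsoOfSurjective w w.surjective) : Fin n → Fin n)
      = (OrderIso.refl (Fin n) : Fin n → Fin n)) i
  simpa using congrArg Fin.val this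

theorem exists_word_length (w : Perm (Fin n)) :
    ∃ l, IsWord w l ∧ l.length = (inversions w).card := by
  induction hk : (inversions w).card generalizing w with
  | zero =>
    refine ⟨[], ⟨by simp, ?_⟩, rfl⟩
    rw [eq_one_of_lt_succ (w := w) fun i j h => ?_, List.prod_nil]
    by_contra hc
    have hij : i ≠ j := by rintro rfl; omega
    have := card_inversions_mul_swap_of_gt h
      (lt_of_le_of_ne (not_lt.1 hc) fun e => hij (w.injective e.symm))
    omega
  | succ k ih =>
    obtain ⟨i, j, h, hw⟩ : ∃ i j : Fin n, (i : ℕ) + 1 = j ∧ w j < w i := by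
      by_contra! hc
      rw [eq_one_of_lt_succ (w := w) fun i j h => lt_of_le_of_ne (hc i j h) fun e => by
        have := w.injective e; subst this; omega] at hk
      simp [inversions_one] at hk
    have := card_inversions_mul_swap_of_gt h hw
    obtain ⟨l, ⟨hl, hp⟩, hlen⟩ := ih (w * swap i j) (by omega)
    refine ⟨l ++ [swap i j], ⟨?_, ?_⟩, by simp [hlen]⟩
    · simp only [List.mem_append, List.mem_singleton]
      rintro s (hs | rfl)
      · exact hl s hs
      · exact ⟨i, j, h, rfl⟩
    · simp [hp, mul_assoc]

theorem card_inversions_le_length {l : List (Perm (Fin n))} {w : Perm (Fin n)}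
    (hl : IsWord w l) : (inversions w).card ≤ l.length := by
  induction l using List.reverseRecOn generalizing w with
  | nil =>
    obtain ⟨-, rfl⟩ := hl
    simp [inversions_one]
  | append_singleton l s ih =>
    obtain ⟨hs, rfl⟩ := hl
    have h1 := ih (w := l.prod) ⟨fun t ht => hs t (by simp [ht]), rfl⟩
    obtain ⟨i, j, h, rfl⟩ := hs s (by simp)
    have hij : i ≠ j := by rintro rfl; omega
    rw [List.prod_append, List.prod_singleton, List.length_append, List.length_singleton]
    rcases lt_or_gt_of_ne (l.prod.injective.ne hij) with h2 | h2
    · rw [card_inversions_mul_swap h h2]; omega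
    · have := card_inversions_mul_swap_of_gt h h2; omega

theorem len_eq_card_inversions (w : Perm (Fin n)) : len w = (inversions w).card := by
  apply le_antisymm
  · exact Nat.sInf_le (exists_word_length w)
  · obtain ⟨l, hl, hlen⟩ := exists_isReducedWord w
    exact hlen ▸ card_inversions_le_length hl

theorem len_mul_swap {w : Perm (Fin n)} {i j : Fin n} (h : (i : ℕ) + 1 = j) (hw : w i < w j) :
    len (w * swap i j) = len w + 1 := by
  rw [len_eq_card_inversions, len_eq_card_inversions, card_inversions_mul_swap h hw]

theorem len_inv_le (w : Perm (Fin n)) : len w⁻¹ ≤ len w := by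
  obtain ⟨l, ⟨hl, hp⟩, hlen⟩ := exists_isReducedWord w
  refine Nat.sInf_le ⟨l.reverse, ⟨fun s hs => hl s (by simpa using hs), ?_⟩, by simpa using hlen⟩
  rw [← hp, List.prod_inv_reverse, List.map_congr_left (g := id), List.map_id]
  intro s hs
  obtain ⟨i, j, -, rfl⟩ := hl s hs
  simp

theorem len_inv (w : Perm (Fin n)) : len w⁻¹ = len w :=
  le_antisymm (len_inv_le w) (by simpa using len_inv_le w⁻¹)

theorem len_swap_mul {w : Perm (Fin n)} {i j : Fin n} (h : (i : ℕ) + 1 = j)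
    (hw : w⁻¹ i < w⁻¹ j) : len (swap i j * w) = len w + 1 := by
  rw [← len_inv, mul_inv_rev, swap_inv, len_mul_swap h hw, len_inv]

/-! ### The Demazure product: left and right actions of simple generators. -/

theorem demazureRight_of_lt {w : Perm (Fin n)} {i j : Fin n} (h : (i : ℕ) + 1 = j)
    (hw : w i < w j) : demazureRight w (swap i j) = w * swap i j := by
  rw [demazureRight, if_pos]
  rw [len_mul_swap h hw]; omega

theorem demazureRight_of_gt {w : Perm (Fin n)} {i j : Fin n} (h : (i : ℕ) + 1 = j)
    (hw : w j < w i) : demazureRight w (swap i j) = w := by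
  rw [demazureRight, if_neg]
  have := card_inversions_mul_swap_of_gt h hw
  rw [len_eq_card_inversions, len_eq_card_inversions]; omega

/-- `s ∘ w` for a simple generator `s`. -/
noncomputable def demazureLeft (s w : Perm (Fin n)) : Perm (Fin n) :=
  (demazureRight w⁻¹ s)⁻¹

theorem demazureLeft_of_lt {w : Perm (Fin n)} {i j : Fin n} (h : (i : ℕ) + 1 = j)
    (hw : w⁻¹ i < w⁻¹ j) : demazureLeft (swap i j) w = swap i j * w := by
  rw [demazureLeft, demazureRight_of_lt h hw]; simp

theorem demazureLeft_of_gt {w : Perm (Fin n)} {i j : Fin n} (h : (i : ℕ) + 1 = j)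
    (hw : w⁻¹ j < w⁻¹ i) : demazureLeft (swap i j) w = w := by
  rw [demazureLeft, demazureRight_of_gt h hw]; simp

theorem lt_or_gt_of_succ (w : Perm (Fin n)) {i j : Fin n} (h : (i : ℕ) + 1 = j) :
    w i < w j ∨ w j < w i :=
  lt_or_gt_of_ne (w.injective.ne (by rintro rfl; omega))

/-- If `w` does not carry `{i, j}` onto `{a, b}`, multiplying on one side leaves the comparison that
governs the other side unchanged. If it does, then `s * w = w * t`, and both orders of application
produce the longer of `w` and `w * t`. -/
theorem demazureLeft_demazureRight {s t : Perm (Fin n)} (hs : s ∈ simpleReflections n)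
    (ht : t ∈ simpleReflections n) (w : Perm (Fin n)) :
    demazureLeft s (demazureRight w t) = demazureRight (demazureLeft s w) t := by
  obtain ⟨a, b, hab, rfl⟩ := hs
  obtain ⟨i, j, hij, rfl⟩ := ht
  have hab' : a < b := by rw [Fin.lt_def]; omega
  have hij' : i < j := by rw [Fin.lt_def]; omega
  by_cases h1 : w i = a ∧ w j = b
  · obtain ⟨rfl, rfl⟩ := h1
    have e : swap (w i) (w j) * w = w * swap i j := by
      rw [Equiv.swap_apply_apply]; group
    rw [demazureRight_of_lt hij hab', demazureLeft_of_gt hab (by simpa using hij'),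
      demazureLeft_of_lt hab (by simpa using hij'), e,
      demazureRight_of_gt hij (by simpa using hab')]
  by_cases h2 : w i = b ∧ w j = a
  · obtain ⟨rfl, rfl⟩ := h2
    rw [demazureRight_of_gt hij hab', demazureLeft_of_gt hab (by simpa using hij'),
      demazureRight_of_gt hij hab']
  have hV : swap a b (w i) < swap a b (w j) ↔ w i < w j :=
    swap_lt_swap_iff hab h1 h2
  have hV' : swap a b (w j) < swap a b (w i) ↔ w j < w i :=
    swap_lt_swap_iff hab (fun h => h2 h.symm) (fun h => h1 h.symm)
  have e1 : ¬ (w⁻¹ a = i ∧ w⁻¹ b = j) := by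
    rintro ⟨rfl, rfl⟩; simp at h1
  have e2 : ¬ (w⁻¹ a = j ∧ w⁻¹ b = i) := by
    rintro ⟨rfl, rfl⟩; simp at h2
  have hP : swap i j (w⁻¹ a) < swap i j (w⁻¹ b) ↔ w⁻¹ a < w⁻¹ b :=
    swap_lt_swap_iff hij e1 e2
  have hP' : swap i j (w⁻¹ b) < swap i j (w⁻¹ a) ↔ w⁻¹ b < w⁻¹ a :=
    swap_lt_swap_iff hij (fun h => e2 h.symm) (fun h => e1 h.symm)
  rcases lt_or_gt_of_succ w hij with hw | hw <;>
    rcases lt_or_gt_of_succ w⁻¹ hab with hv | hv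
  · rw [demazureRight_of_lt hij hw, demazureLeft_of_lt hab hv,
      demazureLeft_of_lt hab (by simpa using hP.2 hv),
      demazureRight_of_lt hij (by simpa using hV.2 hw), mul_assoc]
  · rw [demazureRight_of_lt hij hw, demazureLeft_of_gt hab hv,
      demazureLeft_of_gt hab (by simpa using hP'.2 hv), demazureRight_of_lt hij hw]
  · rw [demazureRight_of_gt hij hw, demazureLeft_of_lt hab hv,
      demazureRight_of_gt hij (by simpa using hV'.2 hw)]
  · rw [demazureRight_of_gt hij hw, demazureLeft_of_gt hab hv, demazureRight_of_gt hij hw]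

theorem demazureLeft_foldl {s : Perm (Fin n)} (hs : s ∈ simpleReflections n)
    {l : List (Perm (Fin n))} (hl : ∀ t ∈ l, t ∈ simpleReflections n) (w : Perm (Fin n)) :
    demazureLeft s (l.foldl demazureRight w) = l.foldl demazureRight (demazureLeft s w) := by
  induction l generalizing w with
  | nil => rfl
  | cons t l ih =>
    rw [List.foldl_cons, List.foldl_cons, ih fun r hr => hl r (by simp [hr]),
      demazureLeft_demazureRight hs (hl t (by simp))]

theorem foldr_foldl {m l : List (Perm (Fin n))} (hm : ∀ t ∈ m, t ∈ simpleReflections n)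
    (hl : ∀ t ∈ l, t ∈ simpleReflections n) (w : Perm (Fin n)) :
    m.foldr demazureLeft (l.foldl demazureRight w) =
      l.foldl demazureRight (m.foldr demazureLeft w) := by
  induction m with
  | nil => rfl
  | cons s m ih =>
    rw [List.foldr_cons, List.foldr_cons, ih fun r hr => hm r (by simp [hr]),
      demazureLeft_foldl (hm s (by simp)) hl]

theorem foldr_demazureLeft (m : List (Perm (Fin n))) (w : Perm (Fin n)) :
    m.foldr demazureLeft w = (m.reverse.foldl demazureRight w⁻¹)⁻¹ := by
  induction m with
  | nil => simp
  | cons s m ih => simp [ih, demazureLeft]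

theorem foldl_one_of_isReducedWord {l : List (Perm (Fin n))} {w : Perm (Fin n)}
    (hl : IsReducedWord w l) : l.foldl demazureRight 1 = w := by
  induction l using List.reverseRecOn generalizing w with
  | nil => exact hl.1.2
  | append_singleton l s ih =>
    obtain ⟨⟨hs, rfl⟩, hlen⟩ := hl
    have hw : IsWord l.prod l := ⟨fun t ht => hs t (by simp [ht]), rfl⟩
    have hle : len l.prod ≤ l.length := Nat.sInf_le ⟨l, hw, rfl⟩
    obtain ⟨i, j, h, rfl⟩ := hs s (by simp)
    rw [List.prod_append, List.prod_singleton] at hlen ⊢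
    rw [List.length_append, List.length_singleton] at hlen
    rcases lt_or_gt_of_succ l.prod h with h2 | h2
    · have := len_mul_swap h h2
      rw [List.foldl_append, ih ⟨hw, by omega⟩, List.foldl_cons, List.foldl_nil,
        demazureRight_of_lt h h2]
    · have := card_inversions_mul_swap_of_gt h h2
      rw [← len_eq_card_inversions, ← len_eq_card_inversions] at this
      omega

theorem IsReducedWord.reverse {l : List (Perm (Fin n))} {w : Perm (Fin n)}
    (hl : IsReducedWord w l) : IsReducedWord w⁻¹ l.reverse := by
  obtain ⟨⟨hs, rfl⟩, hlen⟩ := hl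
  refine ⟨⟨fun s h => hs s (by simpa using h), ?_⟩, by rw [len_inv, List.length_reverse, hlen]⟩
  rw [List.prod_inv_reverse, List.map_congr_left (g := id), List.map_id]
  intro s h
  obtain ⟨i, j, -, rfl⟩ := hs s h
  simp

theorem foldr_one_of_isReducedWord {l : List (Perm (Fin n))} {w : Perm (Fin n)}
    (hl : IsReducedWord w l) : l.foldr demazureLeft 1 = w := by
  rw [foldr_demazureLeft, inv_one, foldl_one_of_isReducedWord hl.reverse, inv_inv]

/-- The right side does not involve `l`, so the Demazure product is independent of the reduced word
chosen for `w`. -/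
theorem foldl_eq_foldr {u w : Perm (Fin n)} {m l : List (Perm (Fin n))}
    (hm : IsReducedWord u m) (hl : IsReducedWord w l) :
    l.foldl demazureRight u = m.foldr demazureLeft w := by
  nth_rewrite 1 [← foldr_one_of_isReducedWord hm]
  rw [← foldr_foldl hm.1.1 hl.1.1, foldl_one_of_isReducedWord hl]

theorem demazure_eq_foldl (u : Perm (Fin n)) {w : Perm (Fin n)} {l : List (Perm (Fin n))}
    (hl : IsReducedWord w l) : demazure u w = l.foldl demazureRight u := by
  obtain ⟨m, hm⟩ := exists_isReducedWord u
  rw [demazure, foldl_eq_foldr hm hl, foldl_eq_foldr hm (exists_isReducedWord w).choose_spec]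

theorem demazure_one (u : Perm (Fin n)) : demazure u 1 = u := by
  rw [demazure_eq_foldl (l := []), List.foldl_nil]
  refine ⟨⟨by simp, rfl⟩, ?_⟩
  have : len (1 : Perm (Fin n)) ≤ 0 := Nat.sInf_le ⟨[], ⟨by simp, rfl⟩, rfl⟩
  rw [List.length_nil]; omega

theorem demazure_swap_mul (v : Perm (Fin n)) {w : Perm (Fin n)} {i j : Fin n}
    (h : (i : ℕ) + 1 = j) (hw : w⁻¹ i < w⁻¹ j) :
    demazure v (swap i j * w) = demazure (demazureRight v (swap i j)) w := by
  obtain ⟨l, hl⟩ := exists_isReducedWord w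
  rw [demazure_eq_foldl _ hl, demazure_eq_foldl (l := swap i j :: l), List.foldl_cons]
  obtain ⟨⟨hs, rfl⟩, hlen⟩ := hl
  refine ⟨⟨?_, by simp⟩, by rw [len_swap_mul h hw, List.length_cons, hlen]⟩
  simp only [List.mem_cons]
  rintro s (rfl | hs')
  · exact ⟨i, j, h, rfl⟩
  · exact hs s hs'

theorem demazure_mul_swap (v : Perm (Fin n)) {w : Perm (Fin n)} {i j : Fin n}
    (h : (i : ℕ) + 1 = j) (hw : w i < w j) :
    demazure v (w * swap i j) = demazureRight (demazure v w) (swap i j) := by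
  obtain ⟨l, hl⟩ := exists_isReducedWord w
  rw [demazure_eq_foldl _ hl, demazure_eq_foldl (l := l ++ [swap i j]), List.foldl_append,
    List.foldl_cons, List.foldl_nil]
  obtain ⟨⟨hs, rfl⟩, hlen⟩ := hl
  refine ⟨⟨?_, by simp⟩, by rw [len_mul_swap h hw, List.length_append, hlen]; rfl⟩
  simp only [List.mem_append, List.mem_singleton]
  rintro s (hs' | rfl)
  · exact hs s hs'
  · exact ⟨i, j, h, rfl⟩

theorem demazureLeft_demazure {s : Perm (Fin n)} (hs : s ∈ simpleReflections n)
    (v w : Perm (Fin n)) : demazure (demazureLeft s v) w = demazureLeft s (demazure v w) := by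
  obtain ⟨l, hl⟩ := exists_isReducedWord w
  rw [demazure_eq_foldl _ hl, demazure_eq_foldl _ hl, demazureLeft_foldl hs hl.1.1]

/-- `(s u) ∘ (s u)⁻¹ = s ∘ (u ∘ u⁻¹) ∘ s` if `s u` is longer than `u`. -/
theorem demazure_inv_swap_mul {u : Perm (Fin n)} {i j : Fin n} (h : (i : ℕ) + 1 = j)
    (hu : u⁻¹ i < u⁻¹ j) :
    demazure (swap i j * u) (swap i j * u)⁻¹ =
      demazureRight (demazureLeft (swap i j) (demazure u u⁻¹)) (swap i j) := by
  rw [mul_inv_rev, swap_inv, demazure_mul_swap _ h hu, ← demazureLeft_of_lt h hu,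
    demazureLeft_demazure ⟨i, j, h, rfl⟩]

/-! ### Rearranging three consecutive entries. -/

theorem swap_braid {i j k : Fin n} (hij : i ≠ j) (hjk : j ≠ k) (hik : i ≠ k) :
    swap i j * swap j k * swap i j = swap j k * swap i j * swap j k := by
  rw [swap_mul_swap_mul_swap hij hik, swap_comm i j, swap_comm j k,
    swap_mul_swap_mul_swap hjk.symm hik.symm, swap_comm]

/-- `u ⋖ v` on permutations: the entries `c, a, b` of `u` with `a < b < c` in three consecutive
positions are replaced by `b, c, a`. -/
def CoverStep (u v : Perm (Fin n)) : Prop :=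
  ∃ i j k : Fin n, (i : ℕ) + 1 = j ∧ (j : ℕ) + 1 = k ∧ u j < u k ∧ u k < u i ∧
    v = u * swap j k * swap i j

section Consecutive

variable {m : Perm (Fin n)} {i j k : Fin n}

theorem ne_of_consecutive (hij : (i : ℕ) + 1 = j) (hjk : (j : ℕ) + 1 = k) :
    i ≠ j ∧ j ≠ k ∧ i ≠ k := by
  simp only [ne_eq, Fin.ext_iff]; omega

/-- A reduced word of the inverse starts with `swap i j`, `swap j k` and continues with one of
`m⁻¹`. The first letter is absorbed, since `c > a` in the first two positions; the second turns
`cab` into `cba`. The next two lemmas reach the same right side: for `bca` the first letter is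
absorbed and the second lengthens, for `cba` all three letters are absorbed. -/
theorem demazure_inv_cab (hij : (i : ℕ) + 1 = j) (hjk : (j : ℕ) + 1 = k) (h1 : m i < m j)
    (h2 : m j < m k) :
    demazure (m * swap j k * swap i j) (m * swap j k * swap i j)⁻¹ =
      demazure (m * swap i j * swap j k * swap i j) m⁻¹ := by
  obtain ⟨n1, n2, n3⟩ := ne_of_consecutive hij hjk
  have e : (m * swap j k * swap i j)⁻¹ = swap i j * (swap j k * m⁻¹) := by simp [mul_assoc]
  rw [e, demazure_swap_mul _ hij, demazureRight_of_gt hij, demazure_swap_mul _ hjk (by simpa),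
    demazureRight_of_lt hjk]
  · congr 1
    rw [mul_assoc, mul_assoc, mul_assoc, mul_assoc, ← mul_assoc (swap i j), swap_braid n1 n2 n3,
      mul_assoc]
  · simpa [swap_apply_of_ne_of_ne, n1, n2, n3, n1.symm, n2.symm, n3.symm] using h1
  · simpa [swap_apply_of_ne_of_ne, n1, n2, n3, n1.symm, n2.symm, n3.symm] using h1.trans h2
  · simpa [swap_apply_of_ne_of_ne, n1, n2, n3, n1.symm, n2.symm, n3.symm] using h1.trans h2

theorem demazure_inv_bca (hij : (i : ℕ) + 1 = j) (hjk : (j : ℕ) + 1 = k) (h1 : m i < m j)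
    (h2 : m j < m k) :
    demazure (m * swap i j * swap j k) (m * swap i j * swap j k)⁻¹ =
      demazure (m * swap i j * swap j k * swap i j) m⁻¹ := by
  obtain ⟨n1, n2, n3⟩ := ne_of_consecutive hij hjk
  have e : (m * swap i j * swap j k)⁻¹ = swap j k * (swap i j * m⁻¹) := by simp [mul_assoc]
  rw [e, demazure_swap_mul _ hjk, demazureRight_of_gt hjk, demazure_swap_mul _ hij (by simpa),
    demazureRight_of_lt hij]
  · simpa [swap_apply_of_ne_of_ne, n1, n2, n3, n1.symm, n2.symm, n3.symm] using h2
  · simpa [swap_apply_of_ne_of_ne, n1, n2, n3, n1.symm, n2.symm, n3.symm] using h1.trans h2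
  · simpa [swap_apply_of_ne_of_ne, n1, n2, n3, n1.symm, n2.symm, n3.symm] using h1.trans h2

theorem demazure_inv_cba (hij : (i : ℕ) + 1 = j) (hjk : (j : ℕ) + 1 = k) (h1 : m i < m j)
    (h2 : m j < m k) :
    demazure (m * swap i j * swap j k * swap i j) (m * swap i j * swap j k * swap i j)⁻¹ =
      demazure (m * swap i j * swap j k * swap i j) m⁻¹ := by
  obtain ⟨n1, n2, n3⟩ := ne_of_consecutive hij hjk
  have e : (m * swap i j * swap j k * swap i j)⁻¹ =
    swap i j * (swap j k * (swap i j * m⁻¹)) := by simp [mul_assoc]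
  rw [e, demazure_swap_mul _ hij, demazureRight_of_gt hij, demazure_swap_mul _ hjk,
    demazureRight_of_gt hjk, demazure_swap_mul _ hij (by simpa), demazureRight_of_gt hij]
  · simpa [swap_apply_of_ne_of_ne, n1, n2, n3, n1.symm, n2.symm, n3.symm] using h2
  · simpa [swap_apply_of_ne_of_ne, n1, n2, n3, n1.symm, n2.symm, n3.symm] using h1
  · simpa [swap_apply_of_ne_of_ne, n1, n2, n3, n1.symm, n2.symm, n3.symm] using h1.trans h2
  · simpa [swap_apply_of_ne_of_ne, n1, n2, n3, n1.symm, n2.symm, n3.symm] using h2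
  · simpa [swap_apply_of_ne_of_ne, n1, n2, n3, n1.symm, n2.symm, n3.symm] using h2

theorem len_cab (hij : (i : ℕ) + 1 = j) (hjk : (j : ℕ) + 1 = k) (h1 : m i < m j)
    (h2 : m j < m k) : len (m * swap j k * swap i j) = len m + 2 := by
  obtain ⟨n1, n2, n3⟩ := ne_of_consecutive hij hjk
  rw [len_mul_swap hij, len_mul_swap hjk h2]
  simpa [swap_apply_of_ne_of_ne, n1, n2, n3, n1.symm, n2.symm, n3.symm] using h1.trans h2

theorem len_bca (hij : (i : ℕ) + 1 = j) (hjk : (j : ℕ) + 1 = k) (h1 : m i < m j)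
    (h2 : m j < m k) : len (m * swap i j * swap j k) = len m + 2 := by
  obtain ⟨n1, n2, n3⟩ := ne_of_consecutive hij hjk
  rw [len_mul_swap hjk, len_mul_swap hij h1]
  simpa [swap_apply_of_ne_of_ne, n1, n2, n3, n1.symm, n2.symm, n3.symm] using h1.trans h2

theorem len_cba (hij : (i : ℕ) + 1 = j) (hjk : (j : ℕ) + 1 = k) (h1 : m i < m j)
    (h2 : m j < m k) : len (m * swap i j * swap j k * swap i j) = len m + 3 := by
  obtain ⟨n1, n2, n3⟩ := ne_of_consecutive hij hjk
  rw [len_mul_swap hij, len_bca hij hjk h1 h2]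
  simpa [swap_apply_of_ne_of_ne, n1, n2, n3, n1.symm, n2.symm, n3.symm] using h2

end Consecutive

theorem CoverStep.exists_base {u v : Perm (Fin n)} (h : CoverStep u v) :
    ∃ (m : Perm (Fin n)) (i j k : Fin n), (i : ℕ) + 1 = j ∧ (j : ℕ) + 1 = k ∧ m i < m j ∧
      m j < m k ∧ u = m * swap j k * swap i j ∧ v = m * swap i j * swap j k := by
  obtain ⟨i, j, k, hij, hjk, h1, h2, rfl⟩ := h
  obtain ⟨n1, n2, n3⟩ := ne_of_consecutive hij hjk
  refine ⟨u * swap i j * swap j k, i, j, k, hij, hjk, ?_, ?_, by simp [mul_assoc], ?_⟩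
  · simpa [swap_apply_of_ne_of_ne, n1, n2, n3, n1.symm, n2.symm, n3.symm] using h1
  · simpa [swap_apply_of_ne_of_ne, n1, n2, n3, n1.symm, n2.symm, n3.symm] using h2
  · have := swap_braid n1 n2 n3
    calc u * swap j k * swap i j = u * (swap j k * swap i j * swap j k) * swap j k := by
          simp [mul_assoc]
      _ = _ := by rw [← this]; simp [mul_assoc]

theorem CoverStep.demazure_eq {u v : Perm (Fin n)} (h : CoverStep u v) :
    demazure u u⁻¹ = demazure v v⁻¹ := by
  obtain ⟨m, i, j, k, hij, hjk, h1, h2, rfl, rfl⟩ := h.exists_base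
  rw [demazure_inv_cab hij hjk h1 h2, demazure_inv_bca hij hjk h1 h2]

theorem CoverStep.len_eq {u v : Perm (Fin n)} (h : CoverStep u v) : len u = len v := by
  obtain ⟨m, i, j, k, hij, hjk, h1, h2, rfl, rfl⟩ := h.exists_base
  rw [len_cab hij hjk h1 h2, len_bca hij hjk h1 h2]

theorem exists_coverStep_of_bca {v : Perm (Fin n)} {i j k : Fin n} (hij : (i : ℕ) + 1 = j)
    (hjk : (j : ℕ) + 1 = k) (h1 : v k < v i) (h2 : v i < v j) : ∃ u, CoverStep u v := by
  obtain ⟨n1, n2, n3⟩ := ne_of_consecutive hij hjk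
  refine ⟨v * swap i j * swap j k, i, j, k, hij, hjk, ?_, ?_, by simp [mul_assoc]⟩
  · simpa [swap_apply_of_ne_of_ne, n1, n2, n3, n1.symm, n2.symm, n3.symm] using h1
  · simpa [swap_apply_of_ne_of_ne, n1, n2, n3, n1.symm, n2.symm, n3.symm] using h2

/-- Inversion preserves length and turns `w⁻¹ ∘ 1 ∘ w` into `u ∘ u⁻¹`; inverse atoms are handled in
this form from here on. -/
theorem mem_inv_atoms {x u : Perm (Fin n)} : u ∈ (fun w => w⁻¹) '' atoms x ↔
    demazure u u⁻¹ = x ∧ ∀ v, demazure v v⁻¹ = x → len u ≤ len v := by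
  simp only [atoms, relAtoms, heckeAtoms, demazureConj, demazure_one, Set.mem_image,
    Set.mem_ofPred_eq]
  constructor
  · rintro ⟨w, ⟨h1, h2⟩, rfl⟩
    refine ⟨by simpa using h1, fun v hv => ?_⟩
    rw [len_inv, ← len_inv v]
    exact h2 _ (by simpa using hv)
  · rintro ⟨h1, h2⟩
    refine ⟨u⁻¹, ⟨by simpa using h1, fun v hv => ?_⟩, inv_inv u⟩
    rw [len_inv, ← len_inv v]
    exact h2 _ (by simpa using hv)

theorem CoverStep.mem_inv_atoms_iff {x u v : Perm (Fin n)} (h : CoverStep u v) :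
    u ∈ (fun w => w⁻¹) '' atoms x ↔ v ∈ (fun w => w⁻¹) '' atoms x := by
  rw [mem_inv_atoms, mem_inv_atoms, h.demazure_eq, h.len_eq]

/-- Replacing `cba` by `cab` keeps `u ∘ u⁻¹` and shortens `u` by one. -/
theorem not_cba_of_mem_inv_atoms {x u : Perm (Fin n)} (hu : u ∈ (fun w => w⁻¹) '' atoms x)
    {i j k : Fin n} (hij : (i : ℕ) + 1 = j) (hjk : (j : ℕ) + 1 = k) :
    ¬ (u k < u j ∧ u j < u i) := by
  rintro ⟨h1, h2⟩
  obtain ⟨n1, n2, n3⟩ := ne_of_consecutive hij hjk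
  obtain ⟨hD, hmin⟩ := mem_inv_atoms.1 hu
  obtain ⟨m, rfl⟩ : ∃ m, u = m * swap i j * swap j k * swap i j :=
    ⟨u * swap i j * swap j k * swap i j, by simp [mul_assoc]⟩
  have h3 : m i < m j := by
    simpa [swap_apply_of_ne_of_ne, n1, n2, n3, n1.symm, n2.symm, n3.symm] using h1
  have h4 : m j < m k := by
    simpa [swap_apply_of_ne_of_ne, n1, n2, n3, n1.symm, n2.symm, n3.symm] using h2
  have := hmin (m * swap j k * swap i j)
    (by rw [← hD, demazure_inv_cab hij hjk h3 h4, demazure_inv_cba hij hjk h3 h4])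
  rw [len_cba hij hjk h3 h4, len_cab hij hjk h3 h4] at this
  omega

/-! ### Words sorted by the minima or maxima of the cycles of an involution. -/

/-- The total preorder of `Fin n` by the value of `μ e (y e)` (where `μ` is `min` or `max`), with
ties broken by putting the larger element first. -/
def KeyLE (μ : ℕ → ℕ → ℕ) (y : Perm (Fin n)) (e f : Fin n) : Prop :=
  μ e (y e) < μ f (y f) ∨ (μ e (y e) = μ f (y f) ∧ (f : ℕ) ≤ e)

/-- The one-line representation of `u` is sorted with respect to `KeyLE μ y`. -/
def KeySorted (μ : ℕ → ℕ → ℕ) (y u : Perm (Fin n)) : Prop :=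
  ∀ p q, p < q → KeyLE μ y (u p) (u q)

theorem KeyLE.trans {μ : ℕ → ℕ → ℕ} {y : Perm (Fin n)} {e f g : Fin n} (h1 : KeyLE μ y e f)
    (h2 : KeyLE μ y f g) : KeyLE μ y e g := by
  unfold KeyLE at *; omega

theorem KeyLE.antisymm {μ : ℕ → ℕ → ℕ} {y : Perm (Fin n)} {e f : Fin n} (h1 : KeyLE μ y e f)
    (h2 : KeyLE μ y f e) : e = f := by
  unfold KeyLE at *; omega

theorem KeySorted.keyLE {μ : ℕ → ℕ → ℕ} {y u : Perm (Fin n)} (h : KeySorted μ y u) {e f : Fin n}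
    (hef : u⁻¹ e < u⁻¹ f) : KeyLE μ y e f := by
  simpa using h _ _ hef

/-- The tie-break makes `KeyLE` antisymmetric, so the entries have only one sorted arrangement. -/
theorem KeySorted.unique {μ : ℕ → ℕ → ℕ} {y u v : Perm (Fin n)} (hu : KeySorted μ y u)
    (hv : KeySorted μ y v) : u = v := by
  have : v⁻¹ * u = 1 := eq_one_of_lt_succ fun i j hij => by
    have hlt : i < j := by rw [Fin.lt_def]; omega
    by_contra hc
    have h1 : v⁻¹ (u j) < v⁻¹ (u i) := lt_of_le_of_ne (not_lt.1 hc) fun e =>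
      hlt.ne' (u.injective (v⁻¹.injective e))
    exact hlt.ne (u.injective ((hu i j hlt).antisymm (hv.keyLE h1)))
  exact (inv_mul_eq_one.1 this).symm

theorem keySorted_of_consecutive {μ : ℕ → ℕ → ℕ} {y u : Perm (Fin n)}
    (h : ∀ i j : Fin n, (i : ℕ) + 1 = j → KeyLE μ y (u i) (u j)) : KeySorted μ y u := by
  have key : ∀ (d : ℕ) (p q : Fin n), (p : ℕ) + d + 1 = q → KeyLE μ y (u p) (u q) := by
    intro d
    induction d with
    | zero => exact fun p q hpq => h p q hpq
    | succ d ih =>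
      intro p q hpq
      exact (ih p ⟨p + d + 1, by omega⟩ rfl).trans (h _ _ (by simp; omega))
  intro p q hpq
  rw [Fin.lt_def] at hpq
  exact key (q - p - 1) p q (by omega)

section Conjugation

variable {μ : ℕ → ℕ → ℕ} {y u : Perm (Fin n)} {i j : Fin n}

/-- The cycle `{i, j}` breaks into two fixed points. Their new keys are `i` and `j`, now listed in
increasing order; no other element has key `i` or `j`, so the adjacent values `i`, `j` compare alike
with every other key. -/
theorem KeySorted.swap_mul_of_apply_eq (hμ : μ = min ∨ μ = max) (hy : ∀ e, y (y e) = e)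
    (hu : KeySorted μ y u) (h : (i : ℕ) + 1 = j) (hlt : u⁻¹ j < u⁻¹ i) (hyi : y i = j) :
    KeySorted μ (swap i j * y) (swap i j * u) := by
  have hyj : y j = i := by rw [← hyi, hy]
  have hij : i ≠ j := by rintro rfl; omega
  have hne : ∀ e, e ≠ i → e ≠ j → (y e ≠ i ∧ y e ≠ j) := fun e h1 h2 =>
    ⟨fun hc => h2 (by rw [← hyi, ← hc, hy]), fun hc => h1 (by rw [← hyj, ← hc, hy])⟩
  have main : ∀ e f : Fin n, u⁻¹ (swap i j e) < u⁻¹ (swap i j f) →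
      KeyLE μ (swap i j * y) e f := by
    intro e f hef
    have hk := hu.keyLE hef
    by_cases e1 : e = i <;> by_cases e2 : e = j <;> by_cases f1 : f = i <;> by_cases f2 : f = j <;>
      first
      | (subst e1; subst e2; exact absurd rfl hij)
      | (subst f1; subst f2; exact absurd rfl hij)
      | skip
    · subst e1; subst f1; exact absurd hef (lt_irrefl _)
    · subst e1; subst f2
      rcases hμ with rfl | rfl <;> simp [KeyLE, hyi, hyj] <;> omega
    · subst e1
      obtain ⟨g1, g2⟩ := hne f f1 f2
      simp only [KeyLE, Perm.mul_apply, swap_apply_left, swap_apply_right, hyi, hyj,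
        swap_apply_of_ne_of_ne f1 f2, swap_apply_of_ne_of_ne g1 g2] at hk ⊢
      simp only [ne_eq, Fin.ext_iff] at f1 f2 g1 g2
      rcases hμ with rfl | rfl <;> omega
    · subst e2; subst f1
      simp only [swap_apply_left, swap_apply_right] at hef
      exact absurd hef (lt_asymm hlt)
    · subst e2; subst f2; exact absurd hef (lt_irrefl _)
    · subst e2
      obtain ⟨g1, g2⟩ := hne f f1 f2
      simp only [KeyLE, Perm.mul_apply, swap_apply_left, swap_apply_right, hyi, hyj,
        swap_apply_of_ne_of_ne f1 f2, swap_apply_of_ne_of_ne g1 g2] at hk ⊢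
      simp only [ne_eq, Fin.ext_iff] at f1 f2 g1 g2
      rcases hμ with rfl | rfl <;> omega
    · subst f1
      obtain ⟨g1, g2⟩ := hne e e1 e2
      simp only [KeyLE, Perm.mul_apply, swap_apply_left, swap_apply_right, hyi, hyj,
        swap_apply_of_ne_of_ne e1 e2, swap_apply_of_ne_of_ne g1 g2] at hk ⊢
      simp only [ne_eq, Fin.ext_iff] at e1 e2 g1 g2
      rcases hμ with rfl | rfl <;> omega
    · subst f2
      obtain ⟨g1, g2⟩ := hne e e1 e2
      simp only [KeyLE, Perm.mul_apply, swap_apply_left, swap_apply_right, hyi, hyj,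
        swap_apply_of_ne_of_ne e1 e2, swap_apply_of_ne_of_ne g1 g2] at hk ⊢
      simp only [ne_eq, Fin.ext_iff] at e1 e2 g1 g2
      rcases hμ with rfl | rfl <;> omega
    · obtain ⟨g1, g2⟩ := hne e e1 e2
      obtain ⟨g3, g4⟩ := hne f f1 f2
      simpa only [KeyLE, Perm.mul_apply, swap_apply_of_ne_of_ne e1 e2,
        swap_apply_of_ne_of_ne f1 f2, swap_apply_of_ne_of_ne g1 g2,
        swap_apply_of_ne_of_ne g3 g4] using hk
  intro p q hpq
  exact main _ _ (by simpa using hpq)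

/-- Conjugation relabels cycles by the transposition, and keys with them, because no cycle is `{i,
j}`. Order could fail only if `i` and `j` were both keys, or if they shared a key; both are
excluded. -/
theorem KeySorted.swap_mul_of_apply_ne (hμ : μ = min ∨ μ = max) (hy : ∀ e, y (y e) = e)
    (hu : KeySorted μ y u) (h : (i : ℕ) + 1 = j) (hlt : u⁻¹ j < u⁻¹ i) (hyi : y i ≠ j) :
    KeySorted μ (swap i j * y * swap i j) (swap i j * u) := by
  have hk := hu.keyLE hlt
  have hv : ∀ a : Fin n, ((a : ℕ) = i ∧ (swap i j a : ℕ) = j) ∨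
      ((a : ℕ) = j ∧ (swap i j a : ℕ) = i) ∨
      ((a : ℕ) ≠ i ∧ (a : ℕ) ≠ j ∧ (swap i j a : ℕ) = a) := by
    intro a
    by_cases h1 : a = i
    · subst h1; simp
    by_cases h2 : a = j
    · subst h2; simp
    rw [swap_apply_of_ne_of_ne h1 h2]
    simp only [Fin.ext_iff] at h1 h2
    omega
  have hf : ∀ a e : Fin n, ((e : ℕ) = a → (y e : ℕ) = y a) ∧ ((y e : ℕ) = a → (e : ℕ) = y a) := by
    intro a e
    refine ⟨fun h => by rw [Fin.ext h], fun h => ?_⟩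
    rw [← Fin.ext h, hy]
  have hyi' : (y i : ℕ) ≠ j := fun hc => hyi (Fin.ext hc)
  have hij := hf i j
  have hyij : (y j : ℕ) ≠ y i := fun hc => by
    have := y.injective (Fin.ext hc); subst this; omega
  have hne : μ j (y j) ≠ μ i (y i) := by
    rcases hμ with rfl | rfl <;> omega
  -- If `i` and `j` were both keys, each would be its own key, and sorting would put `i` before `j`,
  -- against `hlt`.
  have hmid : ∀ e f : Fin n, ¬ (μ e (y e) = i ∧ μ f (y f) = j) := by
    intro e f
    have h1 := hf i e
    have h2 := hf j f
    unfold KeyLE at hk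
    rcases hμ with rfl | rfl <;> omega
  have hM : ∀ e : Fin n, (μ e (y e) = i ∧ μ (swap i j e) (swap i j (y e)) = j) ∨
      (μ e (y e) = j ∧ μ (swap i j e) (swap i j (y e)) = i) ∨
      (μ e (y e) ≠ i ∧ μ e (y e) ≠ j ∧ μ (swap i j e) (swap i j (y e)) = μ e (y e)) := by
    intro e
    rcases le_total e (y e) with hle | hle
    · have hle' : swap i j e ≤ swap i j (y e) := by
        rcases hle.eq_or_lt with heq | hl
        · rw [← heq]
        · exact (swap_lt_swap h hl fun hc => hyi (hc.1 ▸ hc.2)).le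
      rcases hμ with rfl | rfl
      · rw [min_eq_left (Fin.le_def.1 hle), min_eq_left (Fin.le_def.1 hle')]
        exact hv e
      · rw [max_eq_right (Fin.le_def.1 hle), max_eq_right (Fin.le_def.1 hle')]
        exact hv (y e)
    · have hle' : swap i j (y e) ≤ swap i j e := by
        rcases hle.eq_or_lt with heq | hl
        · rw [heq]
        · refine (swap_lt_swap h hl fun hc => hyi ?_).le
          rw [← hc.1, hy, hc.2]
      rcases hμ with rfl | rfl
      · rw [min_eq_right (Fin.le_def.1 hle), min_eq_right (Fin.le_def.1 hle')]
        exact hv (y e)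
      · rw [max_eq_left (Fin.le_def.1 hle), max_eq_left (Fin.le_def.1 hle')]
        exact hv e
  intro p q hpq
  have hpq := hu p q hpq
  simp only [KeyLE, Perm.mul_apply, swap_apply_self] at hpq ⊢
  generalize u p = e at *
  generalize u q = f at *
  have h1 := hM e
  have h2 := hM f
  have h3 := hmid e f
  have h4 := hv e
  have h5 := hv f
  -- The tie-break is safe: `i` and `j` lie in different cycles, so they are never tied.
  have h6 : ¬ ((e : ℕ) = j ∧ (f : ℕ) = i ∧ μ e (y e) = μ f (y f)) := by
    rintro ⟨he, hf, hef⟩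
    rw [Fin.ext he, Fin.ext hf] at hef
    exact hne hef
  generalize μ e (y e) = me at *
  generalize μ f (y f) = mf at *
  generalize μ (swap i j e) (swap i j (y e)) = me' at *
  generalize μ (swap i j f) (swap i j (y f)) = mf' at *
  clear hM hmid hv hf hk hu hy hμ
  omega

/-- A permutation sorted by `KeyLE μ y` satisfies `u ∘ u⁻¹ = y`. -/
theorem KeySorted.demazure_eq (hμ : μ = min ∨ μ = max) (hy : ∀ e, y (y e) = e)
    (hu : KeySorted μ y u) : demazure u u⁻¹ = y := by
  induction hk : len u using Nat.strong_induction_on generalizing u y with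
  | _ k ih =>
  by_cases hc : ∀ i j : Fin n, (i : ℕ) + 1 = j → u⁻¹ i < u⁻¹ j
  · have h1 : u = 1 := inv_eq_one.1 (eq_one_of_lt_succ hc)
    subst h1
    rw [inv_one, demazure_one]
    ext e
    rw [Perm.one_apply]
    -- In the identity word the smaller element of a 2-cycle comes first, whereas the tie-break
    -- demands the larger one first; hence `y` has no 2-cycle.
    by_contra hne
    rcases lt_or_gt_of_ne hne with h | h
    rotate_left
    · have := hu (y e) e (Fin.lt_def.2 h)
      simp only [KeyLE, Perm.one_apply, hy] at this
      rcases hμ with rfl | rfl <;> omega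
    · have := hu e (y e) (Fin.lt_def.2 h)
      simp only [KeyLE, Perm.one_apply, hy] at this
      rcases hμ with rfl | rfl <;> omega
  · push Not at hc
    obtain ⟨i, j, h, hle⟩ := hc
    have hij : i ≠ j := by rintro rfl; omega
    have hlt : u⁻¹ j < u⁻¹ i := lt_of_le_of_ne hle fun e => hij (u⁻¹.injective e.symm)
    have hasc : (swap i j * u)⁻¹ i < (swap i j * u)⁻¹ j := by simpa using hlt
    have e : u = swap i j * (swap i j * u) := by simp [← mul_assoc]
    have hlen : len (swap i j * u) < k := by
      have := len_swap_mul h hasc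
      rw [← e] at this; omega
    -- With `s = swap i j`, peeling the left descent `s` off `u` reduces the claim to `s ∘ y' ∘ s =
    -- y`, where `y'` is the involution of the shorter word: `s * y` if `y` exchanges `i` and `j`,
    -- and `s * y * s` otherwise.
    rw [e, demazure_inv_swap_mul h hasc]
    by_cases hyi : y i = j
    · have hyj : y j = i := by rw [← hyi, hy]
      have hy' : ∀ e, (swap i j * y) ((swap i j * y) e) = e := by
        intro e
        have : swap i j * y = y * swap i j := by
          rw [mul_swap_eq_swap_mul, hyi, hyj, swap_comm]
        nth_rewrite 2 [this]
        simp [hy]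
      rw [ih _ hlen hy' (hu.swap_mul_of_apply_eq hμ hy h hlt hyi) rfl]
      have hinv : (swap i j * y)⁻¹ = swap i j * y := by
        rw [inv_eq_iff_mul_eq_one]; ext e; simpa using congrArg Fin.val (hy' e)
      have hlt' : i < j := by rw [Fin.lt_def]; omega
      rw [demazureLeft_of_lt h (by rw [hinv]; simpa [hyi, hyj] using hlt'), ← mul_assoc,
        swap_mul_self, one_mul, demazureRight_of_gt h (by simpa [hyi, hyj] using hlt')]
    · have hyj : y j ≠ i := fun hc => hyi (by rw [← hc, hy])
      have hy' : ∀ e, (swap i j * y * swap i j) ((swap i j * y * swap i j) e) = e := by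
        simp [hy]
      rw [ih _ hlen hy' (hu.swap_mul_of_apply_ne hμ hy h hlt hyi) rfl]
      have hinv : (swap i j * y * swap i j)⁻¹ = swap i j * y * swap i j := by
        rw [inv_eq_iff_mul_eq_one]; ext e; simpa using congrArg Fin.val (hy' e)
      -- As `j` precedes `i` and the keys differ, the key of `j` is strictly smaller. For `min` that
      -- key must be `y j`; for `max` the key of `i` must be `y i`. This inequality makes both
      -- multiplications by `s` lengthen.
      have hyij : y j < y i := by
        have hk := hu.keyLE hlt
        have hne : y j ≠ y i := y.injective.ne hij.symm
        simp only [ne_eq, Fin.ext_iff] at hyi hyj hne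
        rw [Fin.lt_def]
        rcases hμ with rfl | rfl <;> simp only [KeyLE] at hk <;> omega
      rw [demazureLeft_of_lt h, demazureRight_of_lt h]
      · simp [mul_assoc]
      · simpa using hyij
      · rw [hinv]
        simp only [Perm.mul_apply, swap_apply_left, swap_apply_right]
        exact swap_lt_swap h hyij fun hc => by
          have h1 : j = y i := by rw [← hc.1, hy]
          exact hyi h1.symm

end Conjugation

/-! ### Minimal and maximal words are sorted. -/

/-- If a permutation has no two consecutive descents, then interchanging the positions of each of
its descents is an involution. -/
theorem exists_descent_involution {u : Perm (Fin n)}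
    (hu : ∀ i j k : Fin n, (i : ℕ) + 1 = j → (j : ℕ) + 1 = k → ¬ (u k < u j ∧ u j < u i)) :
    ∃ t : Perm (Fin n), (∀ p, t (t p) = p) ∧
      (∀ p q : Fin n, (p : ℕ) + 1 = q → u q < u p → t p = q) ∧
      ∀ p, t p = p ∨ ((p : ℕ) + 1 = t p ∧ u (t p) < u p) ∨ ((t p : ℕ) + 1 = p ∧ u p < u (t p)) := by
  classical
  let T : Fin n → Fin n → Prop := fun p q =>
    ((p : ℕ) + 1 = q ∧ u q < u p) ∨ ((q : ℕ) + 1 = p ∧ u p < u q)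
  have symm : ∀ p q, T p q → T q p := fun p q h => h.symm
  have uniq : ∀ p q r, T p q → T p r → q = r := by
    rintro p q r (⟨h1, h2⟩ | ⟨h1, h2⟩) (⟨h3, h4⟩ | ⟨h3, h4⟩)
    · exact Fin.ext (by omega)
    · exact absurd ⟨h2, h4⟩ (hu r p q h3 h1)
    · exact absurd ⟨h4, h2⟩ (hu q p r h1 h3)
    · exact Fin.ext (by omega)
  let t : Fin n → Fin n := fun p => if h : ∃ q, T p q then h.choose else p
  have spec : ∀ p q, T p q → T p (t p) := by
    intro p q h
    have h' : ∃ q, T p q := ⟨q, h⟩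
    simp only [t, dif_pos h']
    exact h'.choose_spec
  have tval : ∀ p q, T p q → t p = q := fun p q h => uniq p _ _ (spec p q h) h
  have tcase : ∀ p, t p = p ∨ T p (t p) := by
    intro p
    by_cases h : ∃ q, T p q
    · obtain ⟨q, h⟩ := h
      exact Or.inr (spec p q h)
    · exact Or.inl (by simp only [t, dif_neg h])
  have inv : Function.Involutive t := by
    intro p
    rcases tcase p with h | h
    · rw [h, h]
    · exact tval _ _ (symm _ _ h)
  exact ⟨inv.toPerm, inv, fun p q h1 h2 => tval p q (Or.inl ⟨h1, h2⟩), tcase⟩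

/-- Conjugating the descent involution by `u` pairs the values of each descent. At an ascent `u i <
u j`, either `u j` is the minimum of its cycle, or `j` starts a descent to `u k`, and avoiding `bca`
forces `u i < u k`. So cycle minima increase across ascents. -/
theorem exists_keySorted_min {u : Perm (Fin n)}
    (hu : ∀ i j k : Fin n, (i : ℕ) + 1 = j → (j : ℕ) + 1 = k → ¬ (u k < u j ∧ u j < u i))
    (hu' : ∀ i j k : Fin n, (i : ℕ) + 1 = j → (j : ℕ) + 1 = k → ¬ (u k < u i ∧ u i < u j)) :
    ∃ y : Perm (Fin n), (∀ e, y (y e) = e) ∧ KeySorted min y u := by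
  obtain ⟨t, ht, ht1, ht2⟩ := exists_descent_involution hu
  refine ⟨u * t * u⁻¹, by simp [ht], keySorted_of_consecutive fun i j hij => ?_⟩
  simp only [KeyLE, Perm.mul_apply, Perm.inv_def, symm_apply_apply]
  rcases lt_or_gt_of_succ u hij with h | h
  · have hi := ht2 i
    have hj := ht2 j
    have h3 := hu' i j (t j) hij
    have h4 : u i ≠ u (t j) ∨ (t j : ℕ) = i := by
      by_cases hc : t j = i
      · exact Or.inr (congrArg _ hc)
      · exact Or.inl fun hh => hc (u.injective hh).symm
    have h5 : t i = i → (u (t i) : ℕ) = u i := fun h => by rw [h]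
    have h6 : t j = j → (u (t j) : ℕ) = u j := fun h => by rw [h]
    have h7 : (t j : ℕ) = i → (u (t j) : ℕ) = u i := fun h => by rw [Fin.ext h]
    simp only [ne_eq, Fin.ext_iff, Fin.lt_def] at *
    omega
  · have h1 := ht1 i j hij h
    have h2 : t j = i := by rw [← h1, ht]
    rw [h1, h2]
    rw [Fin.lt_def] at h
    omega

/-- Mirror argument: if `i` ends a descent and `u i < u j` follows, avoiding `cab` forces the first
entry of that descent below `u j`, so cycle maxima increase across ascents. -/
theorem exists_keySorted_max {u : Perm (Fin n)}
    (hu : ∀ i j k : Fin n, (i : ℕ) + 1 = j → (j : ℕ) + 1 = k → ¬ (u k < u j ∧ u j < u i))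
    (hu' : ∀ i j k : Fin n, (i : ℕ) + 1 = j → (j : ℕ) + 1 = k → ¬ (u j < u k ∧ u k < u i)) :
    ∃ y : Perm (Fin n), (∀ e, y (y e) = e) ∧ KeySorted max y u := by
  obtain ⟨t, ht, ht1, ht2⟩ := exists_descent_involution hu
  refine ⟨u * t * u⁻¹, by simp [ht], keySorted_of_consecutive fun i j hij => ?_⟩
  simp only [KeyLE, Perm.mul_apply, Perm.inv_def, symm_apply_apply]
  rcases lt_or_gt_of_succ u hij with h | h
  · have hi := ht2 i
    have hj := ht2 j
    have h3 := hu' (t i) i j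
    have h4 : u j ≠ u (t i) ∨ (t i : ℕ) = j := by
      by_cases hc : t i = j
      · exact Or.inr (congrArg _ hc)
      · exact Or.inl fun hh => hc (u.injective hh).symm
    have h5 : t i = i → (u (t i) : ℕ) = u i := fun h => by rw [h]
    have h6 : t j = j → (u (t j) : ℕ) = u j := fun h => by rw [h]
    have h7 : (t i : ℕ) = j → (u (t i) : ℕ) = u j := fun h => by rw [Fin.ext h]
    have h8 : (t j : ℕ) = i → (u (t j) : ℕ) = u i := fun h => by rw [Fin.ext h]
    simp only [ne_eq, Fin.ext_iff, Fin.lt_def] at *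
    omega
  · have h1 := ht1 i j hij h
    have h2 : t j = i := by rw [← h1, ht]
    rw [h1, h2]
    rw [Fin.lt_def] at h
    omega

/-! ### The extremal permutations are sorted. -/

theorem sublist_eraseDups (l : List (Fin n)) : l.eraseDups.Sublist l := by
  induction h : l.length using Nat.strong_induction_on generalizing l with
  | _ k ih =>
    cases l with
    | nil => simp
    | cons a as =>
      rw [List.eraseDups_cons]
      refine List.Sublist.cons_cons a ((ih _ ?_ _ rfl).trans List.filter_sublist)
      rw [← h, List.length_cons]
      exact Nat.lt_succ_of_le (List.length_filter_le _ _)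

/-- Sortedness can be checked before repeated entries are erased, since erasing leaves a sublist. -/
theorem keySorted_ofOneLine {μ : ℕ → ℕ → ℕ} {y : Perm (Fin n)} {L : List (Fin n × Fin n)}
    (h1 : ∀ p ∈ L, KeyLE μ y p.2 p.1)
    (h2 : L.Pairwise fun p q => ∀ e ∈ [p.2, p.1], ∀ f ∈ [q.2, q.1], KeyLE μ y e f)
    (hd : (interleave L).Nodup) (hm : ∀ i, i ∈ interleave L) :
    KeySorted μ y (ofOneLine (interleave L) hd hm) := by
  have : (interleave L).Pairwise (KeyLE μ y) := by
    refine List.Pairwise.sublist (sublist_eraseDups _) (List.pairwise_flatMap.2 ⟨?_, h2⟩)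
    intro p hp
    simpa using h1 p hp
  rw [← ofFn_ofOneLine _ hd hm, List.pairwise_ofFn] at this
  exact fun p q hpq => this hpq

theorem zeroHat_keySorted (x : Perm (Fin n)) (hx : x⁻¹ = x) :
    KeySorted min x (zeroHat x hx) := by
  have hxx : ∀ e, x (x e) = e := fun e => by nth_rewrite 1 [← hx]; simp
  refine keySorted_ofOneLine ?_ ?_ _ _
  · rintro ⟨a, b⟩ hp
    obtain ⟨h1, h2⟩ := (mem_cycByMin x _).1 hp
    simp only [Fin.le_def] at h1 h2
    subst h2
    simp only [KeyLE, hxx]; omega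
  · refine List.Pairwise.imp_of_mem ?_ (cycByMin_sorted x)
    rintro ⟨a, b⟩ ⟨c, d⟩ hp hq hlt
    obtain ⟨h1, h2⟩ := (mem_cycByMin x _).1 hp
    obtain ⟨h3, h4⟩ := (mem_cycByMin x _).1 hq
    simp only [Fin.le_def, Fin.lt_def] at h1 h2 h3 h4 hlt
    subst h2 h4
    simp only [List.mem_cons, List.not_mem_nil, or_false]
    rintro e (rfl | rfl) f (rfl | rfl) <;> simp only [KeyLE, hxx] <;> omega

theorem oneHat_keySorted (x : Perm (Fin n)) (hx : x⁻¹ = x) :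
    KeySorted max x (oneHat x hx) := by
  have hxx : ∀ e, x (x e) = e := fun e => by nth_rewrite 1 [← hx]; simp
  refine keySorted_ofOneLine ?_ ?_ _ _
  · rintro ⟨a, b⟩ hp
    obtain ⟨h1, h2⟩ := (mem_cycByMax x _).1 hp
    simp only [Fin.le_def] at h1 h2
    subst h2
    simp only [KeyLE, hxx]; omega
  · refine List.Pairwise.imp_of_mem ?_ (cycByMax_sorted x)
    rintro ⟨a, b⟩ ⟨c, d⟩ hp hq hlt
    obtain ⟨h1, h2⟩ := (mem_cycByMax x _).1 hp
    obtain ⟨h3, h4⟩ := (mem_cycByMax x _).1 hq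
    simp only [Fin.le_def, Fin.lt_def] at h1 h2 h3 h4 hlt
    subst h2 h4
    simp only [List.mem_cons, List.not_mem_nil, or_false]
    rintro e (rfl | rfl) f (rfl | rfl) <;> simp only [KeyLE, hxx] <;> omega

/-! ### From integer sequences to permutations: the partial order. -/

theorem oneLine_injective : Function.Injective (oneLine (n := n)) := by
  intro u v h
  have := List.ofFn_injective h
  ext i
  have := congrFun this i
  omega

theorem oneLine_eq_of_eq_off {u v : Perm (Fin n)} {p q : List ℤ} {x y z : ℤ}
    (h : oneLine u = p ++ [x, y, z] ++ q) {i j k : Fin n} (hi : (i : ℕ) = p.length)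
    (hij : (i : ℕ) + 1 = j) (hjk : (j : ℕ) + 1 = k)
    (hv : ∀ l, l ≠ i → l ≠ j → l ≠ k → v l = u l) :
    oneLine v = p ++ [(v i : ℤ) + 1, (v j : ℤ) + 1, (v k : ℤ) + 1] ++ q := by
  have hlen := congrArg List.length h
  simp only [oneLine, List.length_ofFn, List.length_append, List.length_cons,
    List.length_nil] at hlen
  refine List.ext_getElem (by simp [oneLine]; omega) fun m h1 h2 => ?_
  have hm : m < n := by simpa [oneLine] using h1
  have hg : (oneLine u)[m]'(by simpa [oneLine] using hm) =
    (p ++ [x, y, z] ++ q)[m]'(by simp; omega) := by simp only [h]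
  have hval : (oneLine v)[m] = ((v ⟨m, hm⟩ : ℕ) : ℤ) + 1 := by simp [oneLine]
  have hval' : (oneLine u)[m]'(by simpa [oneLine] using hm) = ((u ⟨m, hm⟩ : ℕ) : ℤ) + 1 := by
    simp [oneLine]
  rw [hval]
  rw [hval'] at hg
  by_cases c1 : m = p.length
  · obtain rfl : (⟨m, hm⟩ : Fin n) = i := Fin.ext (by simp; omega)
    subst c1
    simp
  by_cases c2 : m = p.length + 1
  · obtain rfl : (⟨m, hm⟩ : Fin n) = j := Fin.ext (by simp; omega)
    subst c2
    simp
  by_cases c3 : m = p.length + 2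
  · obtain rfl : (⟨m, hm⟩ : Fin n) = k := Fin.ext (by simp; omega)
    subst c3
    simp
  rw [hv, hg]
  · rcases lt_or_ge m p.length with hlt | hge
    · simp [hlt]
    · obtain ⟨d, rfl⟩ : ∃ d, m = p.length + 3 + d := ⟨m - p.length - 3, by omega⟩
      rw [List.getElem_append_right (by simp), List.getElem_append_right (by simp)]
      simp
  all_goals simp only [ne_eq, Fin.ext_iff]; omega

/-- A step from a one-line word never leaves the permutations, so chains of sequences lift to chains
in `S_n`. Distinctness of the entries makes the weak inequalities strict. -/
theorem exists_coverStep_of_atomStep {u : Perm (Fin n)} {l : List ℤ} (h : AtomStep (oneLine u) l) :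
    ∃ v, CoverStep u v ∧ l = oneLine v := by
  obtain ⟨p, q, a, b, c, hab, hbc, hu, rfl⟩ := h
  have hlen := congrArg List.length hu
  simp only [oneLine, List.length_ofFn, List.length_append, List.length_cons,
    List.length_nil] at hlen
  obtain ⟨i, hi⟩ : ∃ i : Fin n, (i : ℕ) = p.length := ⟨⟨p.length, by omega⟩, rfl⟩
  obtain ⟨j, hij⟩ : ∃ j : Fin n, (i : ℕ) + 1 = j := ⟨⟨i + 1, by omega⟩, rfl⟩
  obtain ⟨k, hjk⟩ : ∃ k : Fin n, (j : ℕ) + 1 = k := ⟨⟨j + 1, by omega⟩, rfl⟩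
  obtain ⟨n1, n2, n3⟩ := ne_of_consecutive hij hjk
  have hval := oneLine_eq_of_eq_off hu hi hij hjk (v := u) fun _ _ _ _ => rfl
  rw [hu] at hval
  simp only [List.append_assoc, List.append_cancel_left_eq, List.cons_append, List.nil_append,
    List.cons.injEq, and_true] at hval
  obtain ⟨rfl, rfl, rfl⟩ := hval
  have e1 := u.injective.ne n1
  have e2 := u.injective.ne n2
  have e3 := u.injective.ne n3
  refine ⟨u * swap j k * swap i j, ⟨i, j, k, hij, hjk, ?_, ?_, rfl⟩, ?_⟩
  · exact lt_of_le_of_ne (Fin.le_def.2 (by omega)) e2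
  · exact lt_of_le_of_ne (Fin.le_def.2 (by omega)) e3.symm
  · rw [oneLine_eq_of_eq_off hu hi hij hjk (v := u * swap j k * swap i j)]
    · simp [swap_apply_of_ne_of_ne, n1, n3, n2.symm, n3.symm]
    · intro l h1 h2 h3
      simp [swap_apply_of_ne_of_ne, h1, h2, h3]

theorem CoverStep.atomStep {u v : Perm (Fin n)} (h : CoverStep u v) :
    AtomStep (oneLine u) (oneLine v) := by
  obtain ⟨i, j, k, hij, hjk, h1, h2, rfl⟩ := h
  obtain ⟨n1, n2, n3⟩ := ne_of_consecutive hij hjk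
  have hl : (oneLine u).length = n := by simp [oneLine]
  have hdec : oneLine u = (oneLine u).take i ++ [(oneLine u)[(i : ℕ)], (oneLine u)[(i : ℕ) + 1],
      (oneLine u)[(i : ℕ) + 2]] ++ (oneLine u).drop (i + 3) := by
    conv_lhs => rw [← List.take_append_drop i (oneLine u)]
    rw [List.drop_eq_getElem_cons (i := i) (by omega),
      List.drop_eq_getElem_cons (i := i + 1) (by omega),
      List.drop_eq_getElem_cons (i := i + 2) (by omega)]
    simp
  have hi : (i : ℕ) = ((oneLine u).take i).length := by simp [hl, i.isLt.le]
  refine ⟨_, _, (u j : ℤ) + 1, (u k : ℤ) + 1, (u i : ℤ) + 1, ?_, ?_,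
    oneLine_eq_of_eq_off hdec hi hij hjk fun _ _ _ _ => rfl, ?_⟩
  · rw [Fin.lt_def] at h1; omega
  · rw [Fin.lt_def] at h2; omega
  · rw [oneLine_eq_of_eq_off hdec hi hij hjk (v := u * swap j k * swap i j)]
    · simp [swap_apply_of_ne_of_ne, n1, n3, n2.symm, n3.symm]
    · intro l h1 h2 h3
      simp [swap_apply_of_ne_of_ne, h1, h2, h3]

/-- At the first altered position `c` becomes `b`, a lexicographic decrease; `b = c` would be a
repeated entry. -/
theorem AtomStep.lt {l m : List ℤ} (h : AtomStep l m) (hl : l.Nodup) : m < l := by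
  obtain ⟨p, q, a, b, c, hab, hbc, rfl, rfl⟩ := h
  rcases hbc.lt_or_eq with hbc | rfl
  · rw [List.append_assoc, List.append_assoc]
    exact List.append_left_lt (List.Lex.rel hbc)
  · simp [List.nodup_append] at hl

theorem nodup_oneLine (u : Perm (Fin n)) : (oneLine u).Nodup := by
  refine List.nodup_ofFn.2 fun i j h => u.injective (Fin.ext ?_)
  simpa using h

theorem CoverStep.oneLine_lt {u v : Perm (Fin n)} (h : CoverStep u v) : oneLine v < oneLine u :=
  h.atomStep.lt (nodup_oneLine u)

theorem transGen_coverStep_of_atomLT {u : Perm (Fin n)} {l : List ℤ}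
    (h : AtomLT (oneLine u) l) : ∃ v, Relation.TransGen CoverStep u v ∧ l = oneLine v := by
  induction h with
  | single h =>
    obtain ⟨v, hv, e⟩ := exists_coverStep_of_atomStep h
    exact ⟨v, .single hv, e⟩
  | tail _ h ih =>
    obtain ⟨v, hv, rfl⟩ := ih
    obtain ⟨w, hw, e⟩ := exists_coverStep_of_atomStep h
    exact ⟨w, hv.tail hw, e⟩

theorem atomLT_oneLine_iff {u v : Perm (Fin n)} :
    AtomLT (oneLine u) (oneLine v) ↔ Relation.TransGen CoverStep u v := by
  refine ⟨fun h => ?_, fun h => h.lift oneLine fun _ _ h => h.atomStep⟩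
  obtain ⟨w, hw, e⟩ := transGen_coverStep_of_atomLT h
  rwa [oneLine_injective e]

theorem atomLE_iff {u v : Perm (Fin n)} :
    AtomLE u v ↔ Relation.ReflTransGen CoverStep u v := by
  rw [AtomLE, atomLT_oneLine_iff, Relation.reflTransGen_iff_eq_or_transGen, eq_comm]

theorem oneLine_lt_of_transGen {u v : Perm (Fin n)} (h : Relation.TransGen CoverStep u v) :
    oneLine v < oneLine u := by
  induction h with
  | single h => exact h.oneLine_lt
  | tail _ h ih => exact h.oneLine_lt.trans ih

theorem atomLE_isPartialOrder (n : ℕ) : IsPartialOrder (Perm (Fin n)) AtomLE where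
  refl u := Or.inl rfl
  trans u v w h1 h2 := by
    rw [atomLE_iff] at *
    exact h1.trans h2
  antisymm u v h1 h2 := by
    rcases h1 with rfl | h1
    · rfl
    rcases h2 with rfl | h2
    · rfl
    rw [atomLT_oneLine_iff] at h1 h2
    exact absurd (oneLine_lt_of_transGen h1) (lt_asymm (oneLine_lt_of_transGen h2))

theorem wellFounded_coverStep (n : ℕ) : WellFounded (CoverStep (n := n)) := by
  have : Std.Irrefl (Relation.TransGen (CoverStep (n := n))) :=
    ⟨fun u h => lt_irrefl _ (oneLine_lt_of_transGen h)⟩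
  exact Subrelation.wf (fun h => Relation.TransGen.single h)
    (Finite.wellFounded_of_trans_of_irrefl (Relation.TransGen (CoverStep (n := n))))

theorem wellFounded_flip_coverStep (n : ℕ) :
    WellFounded (fun u v : Perm (Fin n) => CoverStep v u) := by
  have : Std.Irrefl (fun u v : Perm (Fin n) => Relation.TransGen CoverStep v u) :=
    ⟨fun u h => lt_irrefl _ (oneLine_lt_of_transGen h)⟩
  have : IsTrans _ (fun u v : Perm (Fin n) => Relation.TransGen CoverStep v u) :=
    ⟨fun _ _ _ h1 h2 => h2.trans h1⟩
  exact Subrelation.wf (fun h => Relation.TransGen.single h)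
    (Finite.wellFounded_of_trans_of_irrefl
      (fun u v : Perm (Fin n) => Relation.TransGen CoverStep v u))

/-! ### Inverse atoms as an interval. -/

theorem AtomLE.mem_inv_atoms_iff {x u v : Perm (Fin n)} (h : AtomLE u v) :
    u ∈ (fun w => w⁻¹) '' atoms x ↔ v ∈ (fun w => w⁻¹) '' atoms x := by
  rw [atomLE_iff] at h
  induction h with
  | refl => rfl
  | tail _ h ih => rw [ih, h.mem_inv_atoms_iff]

/-- Descend along covering steps, staying among inverse atoms; where no further step down exists,
the word is sorted by cycle minima and must be `0̂(x)`. -/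
theorem zeroHat_atomLE {x : Perm (Fin n)} (hx : x⁻¹ = x) {u : Perm (Fin n)}
    (hu : u ∈ (fun w => w⁻¹) '' atoms x) : AtomLE (zeroHat x hx) u := by
  induction u using (wellFounded_coverStep n).induction with
  | _ u ih =>
  by_cases h : ∃ v, CoverStep v u
  · obtain ⟨v, hv⟩ := h
    have := ih v hv (hv.mem_inv_atoms_iff.2 hu)
    rw [atomLE_iff] at this ⊢
    exact this.tail hv
  · obtain ⟨y, hy, hs⟩ := exists_keySorted_min
      (fun i j k hij hjk => not_cba_of_mem_inv_atoms hu hij hjk)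
      (fun i j k hij hjk hc => h (exists_coverStep_of_bca hij hjk hc.1 hc.2))
    -- The involution read off from the descents is `x`, since both equal `u ∘ u⁻¹`.
    obtain rfl : y = x := by rw [← hs.demazure_eq (Or.inl rfl) hy, (mem_inv_atoms.1 hu).1]
    exact Or.inl ((zeroHat_keySorted y hx).unique hs)

theorem atomLE_oneHat {x : Perm (Fin n)} (hx : x⁻¹ = x) {u : Perm (Fin n)}
    (hu : u ∈ (fun w => w⁻¹) '' atoms x) : AtomLE u (oneHat x hx) := by
  induction u using (wellFounded_flip_coverStep n).induction with
  | _ u ih =>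
  by_cases h : ∃ v, CoverStep u v
  · obtain ⟨v, hv⟩ := h
    have := ih v hv (hv.mem_inv_atoms_iff.1 hu)
    rw [atomLE_iff] at this ⊢
    exact this.head hv
  · obtain ⟨y, hy, hs⟩ := exists_keySorted_max
      (fun i j k hij hjk => not_cba_of_mem_inv_atoms hu hij hjk)
      (fun i j k hij hjk hc => h ⟨_, i, j, k, hij, hjk, hc.1, hc.2, rfl⟩)
    obtain rfl : y = x := by rw [← hs.demazure_eq (Or.inr rfl) hy, (mem_inv_atoms.1 hu).1]
    exact Or.inl (hs.unique (oneHat_keySorted y hx))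

/-- Here `0̂(x)` only shows that some `u` has `u ∘ u⁻¹ = x`. Its minimality of length follows
afterwards, from its being comparable to an inverse atom. -/
theorem inv_atoms_nonempty {x : Perm (Fin n)} (hx : x⁻¹ = x) :
    ((fun w => w⁻¹) '' atoms x).Nonempty := by
  have hxx : ∀ e, x (x e) = e := fun e => by nth_rewrite 1 [← hx]; simp
  have hne : {u : Perm (Fin n) | demazure u u⁻¹ = x}.Nonempty :=
    ⟨zeroHat x hx, (zeroHat_keySorted x hx).demazure_eq (Or.inl rfl) hxx⟩
  obtain ⟨u, hu, hmin⟩ := Set.exists_min_image _ len (Set.toFinite _) hne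
  exact ⟨u, mem_inv_atoms.2 ⟨hu, hmin⟩⟩

theorem zeroHat_mem_inv_atoms {x : Perm (Fin n)} (hx : x⁻¹ = x) :
    zeroHat x hx ∈ (fun w => w⁻¹) '' atoms x := by
  obtain ⟨u, hu⟩ := inv_atoms_nonempty hx
  exact (zeroHat_atomLE hx hu).mem_inv_atoms_iff.2 hu

theorem oneHat_mem_inv_atoms {x : Perm (Fin n)} (hx : x⁻¹ = x) :
    oneHat x hx ∈ (fun w => w⁻¹) '' atoms x := by
  obtain ⟨u, hu⟩ := inv_atoms_nonempty hx
  exact (atomLE_oneHat hx hu).mem_inv_atoms_iff.1 hu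

end InvAtoms

theorem theorem6p11 (n : ℕ) (x : Equiv.Perm (Fin n)) (hx : x⁻¹ = x) :
    IsPartialOrder (Equiv.Perm (Fin n)) InvAtoms.AtomLE ∧
    (fun w => w⁻¹) '' InvAtoms.atoms x = {u | InvAtoms.AtomLE (InvAtoms.zeroHat x hx) u} ∧
    (fun w => w⁻¹) '' InvAtoms.atoms x = {u | InvAtoms.AtomLE u (InvAtoms.oneHat x hx)} ∧
    (fun w => w⁻¹) '' InvAtoms.atoms x =
      {u | InvAtoms.AtomLE (InvAtoms.zeroHat x hx) u ∧
        InvAtoms.AtomLE u (InvAtoms.oneHat x hx)} := by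
  have h0 := InvAtoms.zeroHat_mem_inv_atoms hx
  have h1 := InvAtoms.oneHat_mem_inv_atoms hx
  refine ⟨InvAtoms.atomLE_isPartialOrder n, ?_, ?_, ?_⟩
  · exact Set.ext fun u => ⟨InvAtoms.zeroHat_atomLE hx, fun h => h.mem_inv_atoms_iff.1 h0⟩
  · exact Set.ext fun u => ⟨InvAtoms.atomLE_oneHat hx, fun h => h.mem_inv_atoms_iff.2 h1⟩
  · exact Set.ext fun u => ⟨fun hu => ⟨InvAtoms.zeroHat_atomLE hx hu, InvAtoms.atomLE_oneHat hx hu⟩,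
      fun h => h.1.mem_inv_atoms_iff.1 h0⟩
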